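/- Let $\Omega$ be a nonempty Borel subset of the unit circle $\mathbb{S}^1 \subset \mathbb{R}^2$. Call a set $X \subset \mathbb{R}^2$ an $\Omega$-Kakeya set if for every $e \in \Omega$ it contains a closed unit segment oriented along $e$, that is, there is $a \in \mathbb{R}^2$ with $\{a + te : 0 \le t \le 1\} \subset X$. Then every $\Omega$-Kakeya set $X$ satisfies $$ d_X \ge d_\Omega + 1, $$ where $d_E$ denotes the Hausdorff dimension of a set $E \subset \mathbb{R}^2$. -/

import Mathlib

/-- `X ⊆ ℝⁿ` is an `Ω`-Kakeya set: for every direction `e ∈ Ω` (where `Ω` consists of unit vectors)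
it contains a closed unit segment oriented along `e`. -/
def IsKakeyaFor {n : ℕ} (Ω X : Set (EuclideanSpace ℝ (Fin n))) : Prop :=
  ∀ e ∈ Ω, ∃ a : EuclideanSpace ℝ (Fin n), segment ℝ a (a + e) ⊆ X

/-!
The proof bounds Hausdorff sums of `Ω` directly by those of `X`, with finite sets adapted to a
single scale in place of a Frostman measure on `Ω`.

Decomposing `Ω` into countably many pieces and changing coordinates on each
(`dimH_add_one_le_of_subset_alignedDirections`), one may replace `Ω` by a set `A ⊆ [0, 1)` of slopes
such that for each `m ∈ A` the set `X` contains the graph of `x ↦ m x + b m` over `[0, 1]`. Let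
`0 < t ≤ 1` and `0 < α < 1 + t`. It is enough to show that `X` cannot be null for the
`α`-dimensional Hausdorff measure unless `A` is null for the `t`-dimensional one
(`hausdorffMeasure_slopes_eq_zero`).

Cover `X` by dyadic squares, with a finite family `S k` of squares of side `2^{-k}` and small total
cost `∑ |S k| 2^{-α k}`. Each of the lines is covered by squares, so at some scale `k`, depending on
the line, it meets nearly `2^k` squares of `S k`, up to a factor `r^k` with `r < 1` close to `1`
(`exists_le_card_lineSquares`). This splits `A` into sets `A k`. A maximality argument in place of
Frostman's lemma (`exists_dyadicallyBounded_and_cover`) gives a finite set `F ⊆ A k` with at most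
`2^{t (k - l)}` points in each dyadic interval of length `2^{-l}`, and a cover of `A k` of `t`-cost
at most `2 · 2^{-t k} |F|`. Two lines of slopes `m ≠ m'` share at most `12 / |m - m'|` squares
(`abs_sub_mul_card_inter_lineSquares_le`), so a line with slope in `F` shares `O((k + 1) 2^k)`
squares with all the lines together, and the Cauchy–Schwarz inequality, as in Córdoba's argument for
the Kakeya maximal function, bounds `|F|` by a multiple of `(k + 1) r^{-2k} 2^{-k} |S k|`
(`DyadicallyBounded.sq_mul_card_le`). If `r` is close enough to `1`, the cover of `A k` thus has
`t`-cost at most a constant times `|S k| 2^{-α k}` (`exists_cover_of_many_squares`), and summing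
over `k` bounds the `t`-cost of `A` by the `α`-cost of `X`.
-/

open MeasureTheory Set Filter Topology
open scoped ENNReal NNReal

/-! ### Dyadic intervals and a discrete Frostman lemma -/

/-- The index of the dyadic interval `[j 2⁻ᵏ, (j + 1) 2⁻ᵏ)` that contains `x`. -/
noncomputable def dyad (k : ℕ) (x : ℝ) : ℤ := ⌊(2 : ℝ) ^ k * x⌋

theorem dyad_eq_div {l k : ℕ} (h : l ≤ k) (x : ℝ) :
    dyad l x = dyad k x / ((2 ^ (k - l) : ℕ) : ℤ) := by
  unfold dyad
  rw [← Int.floor_div_natCast]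
  congr 1
  obtain ⟨d, rfl⟩ := Nat.exists_eq_add_of_le h
  simp [pow_add]
  field_simp

theorem dyad_eq_of_le {l k : ℕ} (h : l ≤ k) {x y : ℝ} (hxy : dyad k x = dyad k y) :
    dyad l x = dyad l y := by
  rw [dyad_eq_div h, dyad_eq_div h, hxy]

theorem abs_sub_lt_of_dyad_eq {k : ℕ} {x y : ℝ} (h : dyad k x = dyad k y) :
    2 ^ k * |x - y| < 1 := by
  have := Int.abs_sub_lt_one_of_floor_eq_floor h
  rwa [← mul_sub, abs_mul, abs_of_pos (by positivity)] at this

theorem abs_dyad_sub_le {k : ℕ} {x y : ℝ} {c : ℤ} (h : 2 ^ k * |x - y| ≤ c) :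
    |dyad k x - dyad k y| ≤ c := by
  have h1 : |2 ^ k * x - 2 ^ k * y| ≤ (c : ℝ) := by
    rwa [← mul_sub, abs_mul, abs_of_pos (by positivity)]
  rw [abs_le] at h1 ⊢
  unfold dyad
  constructor
  · have : ⌊(2 : ℝ) ^ k * y⌋ ≤ ⌊(2 : ℝ) ^ k * x⌋ + c := by
      rw [← Int.floor_add_intCast]; exact Int.floor_le_floor (by linarith)
    omega
  · have : ⌊(2 : ℝ) ^ k * x⌋ ≤ ⌊(2 : ℝ) ^ k * y⌋ + c := by
      rw [← Int.floor_add_intCast]; exact Int.floor_le_floor (by linarith)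
    omega

theorem abs_dyad_sub_lt (k : ℕ) (x y : ℝ) :
    |((dyad k x - dyad k y : ℤ) : ℝ)| < 2 ^ k * |x - y| + 1 := by
  have h : 2 ^ k * |x - y| = |2 ^ k * x - 2 ^ k * y| := by
    rw [← mul_sub, abs_mul, abs_of_pos (by positivity : (0 : ℝ) < 2 ^ k)]
  rw [h]
  unfold dyad
  have h1 := Int.floor_le ((2 : ℝ) ^ k * x)
  have h2 := Int.lt_floor_add_one ((2 : ℝ) ^ k * x)
  have h3 := Int.floor_le ((2 : ℝ) ^ k * y)
  have h4 := Int.lt_floor_add_one ((2 : ℝ) ^ k * y)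
  have h5 := le_abs_self (2 ^ k * x - 2 ^ k * y)
  have h6 := neg_abs_le (2 ^ k * x - 2 ^ k * y)
  push_cast
  rw [abs_lt]
  constructor <;> linarith

/-- `F` has at most `2^{t (k - l)}` points in each dyadic interval of length `2^{-l}`, `l ≤ k`. -/
def DyadicallyBounded (t : ℝ) (k : ℕ) (F : Finset ℝ) : Prop :=
  ∀ l ≤ k, ∀ c : ℤ, ((F.filter fun z => dyad l z = c).card : ℝ) ≤ 2 ^ (t * ((k : ℝ) - l))

open Classical in
/-- If `x` cannot be added to `F` without breaking a cap, then some dyadic interval around `x` is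
saturated: `F` fills at least half of its cap there. -/
theorem DyadicallyBounded.exists_saturated {t : ℝ} (ht : 0 ≤ t) {k : ℕ} {F : Finset ℝ}
    (hF : DyadicallyBounded t k F) {x : ℝ}
    (hmax : x ∉ F → ¬ DyadicallyBounded t k (insert x F)) :
    ∃ l ≤ k, (2 : ℝ) ^ (t * ((k : ℝ) - l)) ≤
      2 * (F.filter fun z => dyad l z = dyad l x).card := by
  by_cases hx : x ∈ F
  · refine ⟨k, le_rfl, ?_⟩
    have : 1 ≤ (F.filter fun z => dyad k z = dyad k x).card :=
      Finset.card_pos.2 ⟨x, by simp [hx]⟩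
    have : (1 : ℝ) ≤ (F.filter fun z => dyad k z = dyad k x).card := by exact_mod_cast this
    simp
    linarith
  · have h := hmax hx
    unfold DyadicallyBounded at h
    push Not at h
    obtain ⟨l, hl, c, h⟩ := h
    have hc : dyad l x = c := by
      by_contra hc
      rw [Finset.filter_insert, if_neg hc] at h
      exact absurd (hF l hl c) (not_le.2 h)
    subst hc
    refine ⟨l, hl, ?_⟩
    rw [Finset.filter_insert, if_pos rfl, Finset.card_insert_of_notMem (by simp [hx])] at h
    have h1 : (1 : ℝ) ≤ 2 ^ (t * ((k : ℝ) - l)) := by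
      apply Real.one_le_rpow (by norm_num)
      have : (l : ℝ) ≤ k := by exact_mod_cast hl
      exact mul_nonneg ht (by linarith)
    -- the cap is at least one, so an interval about to overflow already holds a point
    have h2 : 1 ≤ (F.filter fun z => dyad l z = dyad l x).card := by
      have : (1 : ℝ) < ((F.filter fun z => dyad l z = dyad l x).card + 1 : ℕ) := h1.trans_lt h
      have : 1 < (F.filter fun z => dyad l z = dyad l x).card + 1 := by exact_mod_cast this
      omega
    have h3 : (1 : ℝ) ≤ (F.filter fun z => dyad l z = dyad l x).card := by exact_mod_cast h2
    push_cast at h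
    linarith

open Classical in
theorem exists_maximal_dyadicallyBounded (t : ℝ) (k : ℕ) {A : Set ℝ} (hA : A ⊆ Ico 0 1) :
    ∃ F : Finset ℝ, ↑F ⊆ A ∧ DyadicallyBounded t k F ∧
      ∀ x ∈ A, x ∉ F → ¬ DyadicallyBounded t k (insert x F) := by
  let P : ℕ → Prop := fun n => ∃ F : Finset ℝ, ↑F ⊆ A ∧ DyadicallyBounded t k F ∧ F.card = n
  have hP : P 0 := ⟨∅, by simp, by intro l _ c; simp; positivity, rfl⟩
  have hb : ∀ n, P n → n ≤ ⌊(2 : ℝ) ^ (t * k)⌋₊ := by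
    rintro n ⟨F, hFA, hF, rfl⟩
    apply Nat.le_floor
    have h := hF 0 (Nat.zero_le k) 0
    rw [Finset.filter_true_of_mem] at h
    · simpa using h
    · intro z hz
      have := hA (hFA hz)
      simp only [dyad, pow_zero, one_mul]
      exact Int.floor_eq_zero_iff.2 this
  obtain ⟨F, hFA, hF, hn⟩ : P _ := Nat.findGreatest_spec (P := P) (Nat.zero_le _) hP
  refine ⟨F, hFA, hF, fun x hx hxF hcon => ?_⟩
  have h1 : P (F.card + 1) := ⟨insert x F, by
    rw [Finset.coe_insert]; exact insert_subset hx hFA, hcon, Finset.card_insert_of_notMem hxF⟩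
  exact absurd ((Nat.le_findGreatest (hb _ h1) h1).trans_eq hn.symm) (by simp)

open Classical in
/-- A discrete Frostman lemma: a set `A` contains a finite set `F` which is `t`-dimensional down to
scale `2^{-k}`, and whose cardinality is at least `2^{t k}` times, up to a constant, the `t`-cost of
some dyadic cover of `A`. The cover consists of the coarsest intervals saturated by a maximal `F`;
these are disjoint, so their caps add up to at most `2 |F|`. An interval is encoded as a pair
`(l, j)`, its scale and its index. -/
theorem exists_dyadicallyBounded_and_cover {t : ℝ} (ht : 0 ≤ t) (k : ℕ) {A : Set ℝ}
    (hA : A ⊆ Ico 0 1) :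
    ∃ F : Finset ℝ, ↑F ⊆ A ∧ DyadicallyBounded t k F ∧
      ∃ C : Finset (ℕ × ℤ), (∀ x ∈ A, ∃ c ∈ C, dyad c.1 x = c.2) ∧
        ∑ c ∈ C, (2 : ℝ) ^ (-(t * c.1)) ≤ 2 * 2 ^ (-(t * k)) * F.card := by
  obtain ⟨F, hFA, hF, hmax⟩ := exists_maximal_dyadicallyBounded t k hA
  refine ⟨F, hFA, hF, ?_⟩
  let sat : ℕ → ℝ → Prop := fun l x =>
    (2 : ℝ) ^ (t * ((k : ℝ) - l)) ≤ 2 * (F.filter fun z => dyad l z = dyad l x).card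
  have hsat : ∀ x ∈ A, ∃ l, sat l x := fun x hx =>
    let ⟨l, _, h⟩ := hF.exists_saturated ht (hmax x hx)
    ⟨l, h⟩
  have hcongr : ∀ l x y, dyad l x = dyad l y → sat l x → sat l y := by
    intro l x y h hx
    simpa only [sat, h] using hx
  -- the coarsest saturated scale at `x`; the value `0` outside `A` plays no role
  let lev : ℝ → ℕ := fun x => if h : ∃ l, sat l x then Nat.find h else 0
  have hlev : ∀ x ∈ A, sat (lev x) x := by
    intro x hx
    have h := hsat x hx
    simp only [lev, dif_pos h]
    exact Nat.find_spec h
  have hmin : ∀ x l, sat l x → lev x ≤ l := by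
    intro x l h
    have h' : ∃ l, sat l x := ⟨l, h⟩
    simp only [lev, dif_pos h']
    exact Nat.find_min' h' h
  let I : ℝ → ℕ × ℤ := fun x => (lev x, dyad (lev x) x)
  -- points of `F` in the coarsest saturated interval of `x` have the same coarsest interval
  have hI : ∀ x ∈ A, ∀ z ∈ F, dyad (lev x) z = dyad (lev x) x → I z = I x := by
    intro x hx z hz h
    have h1 : lev z ≤ lev x := hmin _ _ (hcongr _ _ _ h.symm (hlev x hx))
    have h2 : lev x ≤ lev z := hmin _ _ (hcongr _ _ _ (dyad_eq_of_le h1 h) (hlev z (hFA hz)))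
    have h3 : lev z = lev x := le_antisymm h1 h2
    simp only [I, h3, h]
  have hbound : ∀ x ∈ A, (2 : ℝ) ^ (-(t * (I x).1)) ≤
      2 * 2 ^ (-(t * k)) * (F.filter fun z => I z = I x).card := by
    intro x hx
    have h1 : (F.filter fun z => dyad (lev x) z = dyad (lev x) x).card ≤
        (F.filter fun z => I z = I x).card := by
      apply Finset.card_le_card
      intro z hz
      rw [Finset.mem_filter] at hz ⊢
      exact ⟨hz.1, hI x hx z hz.1 hz.2⟩
    have h1' : ((F.filter fun z => dyad (lev x) z = dyad (lev x) x).card : ℝ) ≤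
        (F.filter fun z => I z = I x).card := by exact_mod_cast h1
    have h2 : (2 : ℝ) ^ (t * ((k : ℝ) - lev x)) ≤ _ := hlev x hx
    have h3 : (2 : ℝ) ^ (-(t * (I x).1)) = 2 ^ (-(t * k)) * 2 ^ (t * ((k : ℝ) - lev x)) := by
      rw [← Real.rpow_add (by norm_num)]; congr 1; simp only [I]; ring
    rw [h3, mul_comm 2, mul_assoc]
    exact mul_le_mul_of_nonneg_left (by linarith) (by positivity)
  refine ⟨F.image I, ?_, ?_⟩
  · intro x hx
    have hpos : 0 < (F.filter fun z => dyad (lev x) z = dyad (lev x) x).card := by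
      have h2 : (2 : ℝ) ^ (t * ((k : ℝ) - lev x)) ≤ _ := hlev x hx
      have h3 : (0 : ℝ) < 2 ^ (t * ((k : ℝ) - lev x)) := by positivity
      have : (0 : ℝ) < (F.filter fun z => dyad (lev x) z = dyad (lev x) x).card := by linarith
      exact_mod_cast this
    obtain ⟨z, hz⟩ := Finset.card_pos.1 hpos
    rw [Finset.mem_filter] at hz
    exact ⟨I x, Finset.mem_image.2 ⟨z, hz.1, hI x hx z hz.1 hz.2⟩, rfl⟩
  · calc ∑ c ∈ F.image I, (2 : ℝ) ^ (-(t * c.1))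
        ≤ ∑ c ∈ F.image I, 2 * 2 ^ (-(t * k)) * ((F.filter fun z => I z = c).card : ℝ) := by
          apply Finset.sum_le_sum
          intro c hc
          obtain ⟨z, hz, rfl⟩ := Finset.mem_image.1 hc
          exact hbound z (hFA hz)
      _ = 2 * 2 ^ (-(t * k)) * F.card := by
          rw [← Finset.mul_sum, Finset.card_eq_sum_card_image I F]
          push_cast
          rfl

/-! ### Incidences between lines and dyadic squares -/

theorem card_le_of_abs_sub_le {T : Finset ℤ} {M : ℝ} (hM : 0 ≤ M)
    (h : ∀ i ∈ T, ∀ j ∈ T, |((i - j : ℤ) : ℝ)| ≤ M) : (T.card : ℝ) ≤ M + 1 := by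
  rcases T.eq_empty_or_nonempty with rfl | hT
  · simp; linarith
  have h1 : T ⊆ Finset.Icc (T.min' hT) (T.max' hT) := fun i hi =>
    Finset.mem_Icc.2 ⟨T.min'_le i hi, T.le_max' i hi⟩
  have h2 := Finset.card_le_card h1
  rw [Int.card_Icc] at h2
  have h3 := le_of_abs_le (h _ (T.max'_mem hT) _ (T.min'_mem hT))
  have h4 : T.min' hT ≤ T.max' hT := T.min'_le _ (T.max'_mem hT)
  have h5 : (T.card : ℤ) ≤ T.max' hT + 1 - T.min' hT := by omega
  have h6 : (T.card : ℝ) ≤ T.max' hT + 1 - T.min' hT := by exact_mod_cast h5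
  push_cast at h3
  linarith

open Classical in
/-- The squares of `S`, a family of dyadic squares of side `2^{-k}` given by their indices, that
meet the graph of `x ↦ m x + b` over `[0, 1)`. -/
noncomputable def lineSquares (S : Finset (ℤ × ℤ)) (k : ℕ) (m b : ℝ) : Finset (ℤ × ℤ) :=
  S.filter fun s => ∃ x ∈ Ico (0 : ℝ) 1, (dyad k x, dyad k (m * x + b)) = s

section

variable {S : Finset (ℤ × ℤ)} {k : ℕ} {m b m' b' : ℝ}

theorem mem_lineSquares {s : ℤ × ℤ} : s ∈ lineSquares S k m b ↔
    s ∈ S ∧ ∃ x ∈ Ico (0 : ℝ) 1, dyad k x = s.1 ∧ dyad k (m * x + b) = s.2 := by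
  simp [lineSquares, Prod.ext_iff]

/-- A line of slope in `[0, 1)` meets at most two squares in each column. -/
theorem card_le_two_mul_card_columns (hm : m ∈ Ico (0 : ℝ) 1) {T : Finset (ℤ × ℤ)}
    (hT : T ⊆ lineSquares S k m b) : T.card ≤ 2 * (T.image Prod.fst).card := by
  apply Finset.card_le_mul_card_image
  intro i _
  have hinj : Set.InjOn Prod.snd ((T.filter fun s => s.1 = i : Finset (ℤ × ℤ)) : Set (ℤ × ℤ)) := by
    intro s hs s' hs' h
    simp only [Finset.coe_filter, mem_ofPred_eq] at hs hs'
    exact Prod.ext (hs.2.trans hs'.2.symm) h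
  rw [← Finset.card_image_of_injOn hinj]
  suffices h : (((T.filter fun s => s.1 = i).image Prod.snd).card : ℝ) ≤ 1 + 1 by
    norm_num at h; exact_mod_cast h
  apply card_le_of_abs_sub_le zero_le_one
  intro j hj j' hj'
  simp only [Finset.mem_image, Finset.mem_filter] at hj hj'
  obtain ⟨s, ⟨hs, rfl⟩, rfl⟩ := hj
  obtain ⟨s', ⟨hs', hi⟩, rfl⟩ := hj'
  obtain ⟨-, x, -, hx, hy⟩ := mem_lineSquares.1 (hT hs)
  obtain ⟨-, x', -, hx', hy'⟩ := mem_lineSquares.1 (hT hs')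
  have h1 := abs_sub_lt_of_dyad_eq (k := k) (hx.trans (hi.symm.trans hx'.symm))
  have h2 : |dyad k (m * x + b) - dyad k (m * x' + b)| ≤ 1 := by
    apply abs_dyad_sub_le
    have : m * x + b - (m * x' + b) = m * (x - x') := by ring
    rw [this, abs_mul, abs_of_nonneg hm.1]
    have h3 : m * (2 ^ k * |x - x'|) ≤ 1 := mul_le_one₀ hm.2.le (by positivity) h1.le
    push_cast
    linarith
  rw [hy, hy'] at h2
  exact_mod_cast h2

theorem card_lineSquares_le (hm : m ∈ Ico (0 : ℝ) 1) :
    (lineSquares S k m b).card ≤ 2 * 2 ^ k := by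
  refine (card_le_two_mul_card_columns hm subset_rfl).trans (Nat.mul_le_mul_left 2 ?_)
  have h : (lineSquares S k m b).image Prod.fst ⊆ Finset.Ico 0 (2 ^ k) := by
    intro i hi
    obtain ⟨s, hs, rfl⟩ := Finset.mem_image.1 hi
    obtain ⟨-, x, hx, hx1, -⟩ := mem_lineSquares.1 hs
    rw [Finset.mem_Ico, ← hx1, dyad]
    constructor
    · exact Int.floor_nonneg.2 (mul_nonneg (by positivity) hx.1)
    · rw [Int.floor_lt]
      push_cast
      have : (0 : ℝ) < 2 ^ k := by positivity
      nlinarith [hx.2]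
  have h2 := Finset.card_le_card h
  rw [Int.card_Ico] at h2
  have : ((2 : ℤ) ^ k - 0).toNat = 2 ^ k := by
    rw [sub_zero]; exact_mod_cast Int.toNat_natCast (2 ^ k)
  omega

/-- Two lines of slopes `m` and `m'` are within `2 · 2^{-k}` of each other, measured vertically,
over any column in which they share a square. Their vertical distance changes at rate `|m - m'|`,
so these columns lie in a range of length `O(1 / |m - m'|)`. -/
theorem abs_sub_mul_card_inter_lineSquares_le (hm : m ∈ Ico (0 : ℝ) 1) (hm' : m' ∈ Ico (0 : ℝ) 1) :
    |m - m'| * (lineSquares S k m b ∩ lineSquares S k m' b').card ≤ 12 := by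
  rcases eq_or_ne m m' with rfl | hne
  · simp
  have hpos : 0 < |m - m'| := abs_pos.2 (sub_ne_zero.2 hne)
  have hle : |m - m'| ≤ 1 := by
    rw [abs_le]; constructor <;> linarith [hm.1, hm.2, hm'.1, hm'.2]
  set T := lineSquares S k m b ∩ lineSquares S k m' b' with hT
  have key : ∀ s ∈ T, ∃ x, dyad k x = s.1 ∧ 2 ^ k * |(m - m') * x + (b - b')| ≤ 2 := by
    intro s hs
    rw [hT, Finset.mem_inter] at hs
    obtain ⟨-, x, -, hx, hy⟩ := mem_lineSquares.1 hs.1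
    obtain ⟨-, x', -, hx', hy'⟩ := mem_lineSquares.1 hs.2
    refine ⟨x, hx, ?_⟩
    have h1 := abs_sub_lt_of_dyad_eq (k := k) (hx.trans hx'.symm)
    have h2 := abs_sub_lt_of_dyad_eq (k := k) (hy.trans hy'.symm)
    have h3 : (m - m') * x + (b - b') = (m * x + b - (m' * x' + b')) - m' * (x - x') := by ring
    have h4 : |(m - m') * x + (b - b')| ≤ |m * x + b - (m' * x' + b')| + m' * |x - x'| := by
      rw [h3]
      refine (abs_sub _ _).trans ?_
      rw [abs_mul, abs_of_nonneg hm'.1]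
    have h5 : m' * (2 ^ k * |x - x'|) ≤ 1 := mul_le_one₀ hm'.2.le (by positivity) h1.le
    calc 2 ^ k * |(m - m') * x + (b - b')|
        ≤ 2 ^ k * (|m * x + b - (m' * x' + b')| + m' * |x - x'|) := by gcongr
      _ ≤ 2 := by linarith
  have hcol : ((T.image Prod.fst).card : ℝ) ≤ (1 + 4 / |m - m'|) + 1 := by
    apply card_le_of_abs_sub_le (by positivity)
    intro i hi i' hi'
    obtain ⟨s, hs, rfl⟩ := Finset.mem_image.1 hi
    obtain ⟨s', hs', rfl⟩ := Finset.mem_image.1 hi'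
    obtain ⟨x, hx, h⟩ := key s hs
    obtain ⟨x', hx', h'⟩ := key s' hs'
    rw [← hx, ← hx']
    refine (abs_dyad_sub_lt k x x').le.trans ?_
    have h1 : |m - m'| * |x - x'| ≤ |(m - m') * x + (b - b')| + |(m - m') * x' + (b - b')| := by
      rw [← abs_mul]
      refine le_trans (le_of_eq ?_) (abs_sub _ _)
      congr 1; ring
    have h2 : 2 ^ k * |x - x'| ≤ 4 / |m - m'| := by
      rw [le_div_iff₀ hpos]
      have : (2 : ℝ) ^ k * (|m - m'| * |x - x'|) ≤
          2 ^ k * (|(m - m') * x + (b - b')| + |(m - m') * x' + (b - b')|) := by gcongr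
      linarith
    linarith
  have h2 : (T.card : ℝ) ≤ 2 * (T.image Prod.fst).card := by
    exact_mod_cast card_le_two_mul_card_columns hm Finset.inter_subset_left
  calc |m - m'| * T.card ≤ |m - m'| * (2 * ((1 + 4 / |m - m'|) + 1)) := by gcongr; linarith
    _ = 4 * |m - m'| + 8 := by field_simp; ring
    _ ≤ 12 := by linarith

end

open Classical in
/-- The bound `min (2 ^ k) |z - z'|⁻¹` for the number of common squares, written as a sum over
the dyadic scales at which `z` and `z'` lie in equal or neighbouring intervals. -/
theorem card_inter_lineSquares_le_sum {S : Finset (ℤ × ℤ)} {k : ℕ} {z z' b b' : ℝ}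
    (hz : z ∈ Ico (0 : ℝ) 1) (hz' : z' ∈ Ico (0 : ℝ) 1) :
    ((lineSquares S k z b ∩ lineSquares S k z' b').card : ℝ) ≤
      ∑ l ∈ Finset.range (k + 1), if |dyad l z' - dyad l z| ≤ 1 then 24 * (2 : ℝ) ^ l else 0 := by
  have hle : |z' - z| ≤ 1 := by
    rw [abs_le]; constructor <;> linarith [hz.1, hz.2, hz'.1, hz'.2]
  set P : ℕ → Prop := fun l => 2 ^ l * |z' - z| ≤ 1
  set l := Nat.findGreatest P k
  have hl : P l := Nat.findGreatest_spec (Nat.zero_le k) (by simpa [P] using hle)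
  have hlk : l ≤ k := Nat.findGreatest_le k
  have hterm : ((lineSquares S k z b ∩ lineSquares S k z' b').card : ℝ) ≤ 24 * 2 ^ l := by
    rcases hlk.eq_or_lt with h | h
    · have h1 : ((lineSquares S k z b ∩ lineSquares S k z' b').card : ℝ) ≤ 2 * 2 ^ k := by
        exact_mod_cast (Finset.card_le_card Finset.inter_subset_left).trans (card_lineSquares_le hz)
      rw [h]
      have : (0 : ℝ) < 2 ^ k := by positivity
      linarith
    · have h1 : ¬ P (l + 1) := Nat.findGreatest_is_greatest (Nat.lt_succ_self l) h
      have h2 : 1 < 2 ^ (l + 1) * |z' - z| := not_le.1 h1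
      have h3 := abs_sub_mul_card_inter_lineSquares_le (S := S) (k := k) (b := b) (b' := b') hz hz'
      rw [abs_sub_comm] at h3
      set N : ℝ := ((lineSquares S k z b ∩ lineSquares S k z' b').card : ℝ)
      have hN : 0 ≤ N := Nat.cast_nonneg _
      calc N ≤ 2 ^ (l + 1) * |z' - z| * N := le_mul_of_one_le_left hN h2.le
        _ = 2 ^ (l + 1) * (|z' - z| * N) := by ring
        _ ≤ 2 ^ (l + 1) * 12 := by gcongr
        _ = 24 * 2 ^ l := by ring
  refine hterm.trans ?_
  have h1 : |dyad l z' - dyad l z| ≤ 1 := abs_dyad_sub_le (by simpa [P] using hl)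
  calc (24 : ℝ) * 2 ^ l = if |dyad l z' - dyad l z| ≤ 1 then 24 * (2 : ℝ) ^ l else 0 := by
        rw [if_pos h1]
    _ ≤ _ := by
        refine Finset.single_le_sum (f := fun l => if |dyad l z' - dyad l z| ≤ 1
          then 24 * (2 : ℝ) ^ l else 0) (fun i _ => ?_) (Finset.mem_range.2 (Nat.lt_succ_of_le hlk))
        split_ifs <;> positivity

theorem DyadicallyBounded.card_filter_abs_sub_le {t : ℝ} {k : ℕ} {F : Finset ℝ}
    (hF : DyadicallyBounded t k F) {l : ℕ} (hl : l ≤ k) (c : ℤ) :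
    ((F.filter fun z => |dyad l z - c| ≤ 1).card : ℝ) ≤ 3 * 2 ^ (t * ((k : ℝ) - l)) := by
  classical
  have h : (F.filter fun z => |dyad l z - c| ≤ 1) ⊆
      (F.filter fun z => dyad l z = c - 1) ∪ (F.filter fun z => dyad l z = c) ∪
        (F.filter fun z => dyad l z = c + 1) := by
    intro z hz
    simp only [Finset.mem_filter, Finset.mem_union, abs_le] at hz ⊢
    obtain ⟨hz, h1, h2⟩ := hz
    simp only [hz, true_and]
    omega
  have h1 := (Finset.card_le_card h).trans ((Finset.card_union_le _ _).trans
    (Nat.add_le_add_right (Finset.card_union_le _ _) _))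
  have h2 : ((F.filter fun z => |dyad l z - c| ≤ 1).card : ℝ) ≤
      (F.filter fun z => dyad l z = c - 1).card + (F.filter fun z => dyad l z = c).card +
        (F.filter fun z => dyad l z = c + 1).card := by exact_mod_cast h1
  linarith [hF l hl (c - 1), hF l hl c, hF l hl (c + 1)]

open Classical in
/-- The energy bound: a dyadic scale `l` contributes at most `2^l · 2^{t (k - l)} ≤ 2^k` up to a
constant, whence the factor `k + 1`. -/
theorem DyadicallyBounded.sum_card_inter_lineSquares_le {t : ℝ} (ht : t ≤ 1) {k : ℕ}
    {F : Finset ℝ} (hF : DyadicallyBounded t k F) (hF1 : ↑F ⊆ Ico (0 : ℝ) 1)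
    (S : Finset (ℤ × ℤ)) (b : ℝ → ℝ) {z : ℝ} (hz : z ∈ F) :
    ∑ z' ∈ F, ((lineSquares S k z (b z) ∩ lineSquares S k z' (b z')).card : ℝ) ≤
      72 * (k + 1) * 2 ^ k := by
  calc ∑ z' ∈ F, ((lineSquares S k z (b z) ∩ lineSquares S k z' (b z')).card : ℝ)
      ≤ ∑ z' ∈ F, ∑ l ∈ Finset.range (k + 1),
          if |dyad l z' - dyad l z| ≤ 1 then 24 * (2 : ℝ) ^ l else 0 :=
        Finset.sum_le_sum fun z' hz' => card_inter_lineSquares_le_sum (hF1 hz) (hF1 hz')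
    _ = ∑ l ∈ Finset.range (k + 1), 24 * (2 : ℝ) ^ l *
          (F.filter fun z' => |dyad l z' - dyad l z| ≤ 1).card := by
        rw [Finset.sum_comm]
        refine Finset.sum_congr rfl fun l _ => ?_
        rw [← Finset.sum_filter, Finset.sum_const, nsmul_eq_mul, mul_comm]
    _ ≤ ∑ l ∈ Finset.range (k + 1), 72 * (2 : ℝ) ^ k := by
        refine Finset.sum_le_sum fun l hl => ?_
        have hl : l ≤ k := Nat.lt_succ_iff.1 (Finset.mem_range.1 hl)
        have hlk : (l : ℝ) ≤ k := by exact_mod_cast hl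
        have h1 : (2 : ℝ) ^ (t * ((k : ℝ) - l)) ≤ 2 ^ (k - l) := by
          rw [← Real.rpow_natCast, Nat.cast_sub hl]
          apply Real.rpow_le_rpow_of_exponent_le (by norm_num)
          nlinarith
        have h2 := hF.card_filter_abs_sub_le hl (dyad l z)
        calc 24 * (2 : ℝ) ^ l * (F.filter fun z' => |dyad l z' - dyad l z| ≤ 1).card
            ≤ 24 * (2 : ℝ) ^ l * (3 * 2 ^ (k - l)) := by gcongr; linarith
          _ = 72 * (2 ^ l * 2 ^ (k - l)) := by ring
          _ = 72 * 2 ^ k := by rw [← pow_add, Nat.add_sub_cancel' hl]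
    _ = 72 * (k + 1) * 2 ^ k := by simp; ring

/-- The Cauchy–Schwarz inequality for incidences. -/
theorem sq_sum_card_le {α β : Type*} [DecidableEq β] (F : Finset α) (S : Finset β)
    (J : α → Finset β)
    (hJ : ∀ z ∈ F, J z ⊆ S) :
    (∑ z ∈ F, ((J z).card : ℝ)) ^ 2 ≤
      S.card * ∑ z ∈ F, ∑ z' ∈ F, ((J z ∩ J z').card : ℝ) := by
  have hc : ∀ T : Finset β, T ⊆ S → (T.card : ℝ) = ∑ s ∈ S, if s ∈ T then (1 : ℝ) else 0 := by
    intro T hT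
    rw [← Finset.sum_filter, Finset.filter_mem_eq_inter, Finset.inter_eq_right.2 hT]
    simp
  have h1 : ∑ z ∈ F, ((J z).card : ℝ) = ∑ s ∈ S, ∑ z ∈ F, if s ∈ J z then (1 : ℝ) else 0 := by
    rw [Finset.sum_comm]
    exact Finset.sum_congr rfl fun z hz => hc _ (hJ z hz)
  have h2 : ∑ z ∈ F, ∑ z' ∈ F, ((J z ∩ J z').card : ℝ) =
      ∑ s ∈ S, (∑ z ∈ F, if s ∈ J z then (1 : ℝ) else 0) ^ 2 := by
    simp_rw [sq, Finset.sum_mul_sum]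
    rw [Finset.sum_comm]
    rw [Finset.sum_comm (s := S)]
    rw [Finset.sum_comm (s := F)]
    refine Finset.sum_congr rfl fun z hz => ?_
    rw [Finset.sum_comm]
    refine Finset.sum_congr rfl fun z' _ => ?_
    rw [hc _ (Finset.inter_subset_left.trans (hJ z hz))]
    refine Finset.sum_congr rfl fun s _ => ?_
    by_cases h : s ∈ J z <;> by_cases h' : s ∈ J z' <;> simp [h, h']
  rw [h1, h2]
  exact sq_sum_le_card_mul_sum_sq

/-- Córdoba's `L²` argument: if each of the lines with slopes in `F` meets at least `M` squares of
`S`, then `S` is large. -/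
theorem DyadicallyBounded.sq_mul_card_le {t : ℝ} (ht : t ≤ 1) {k : ℕ} {F : Finset ℝ}
    (hF : DyadicallyBounded t k F) (hF1 : ↑F ⊆ Ico (0 : ℝ) 1) (S : Finset (ℤ × ℤ)) (b : ℝ → ℝ)
    {M : ℝ} (hM : 0 ≤ M) (hFM : ∀ z ∈ F, M ≤ (lineSquares S k z (b z)).card) :
    M ^ 2 * F.card ≤ 72 * (k + 1) * 2 ^ k * S.card := by
  rcases F.eq_empty_or_nonempty with rfl | hne
  · simp; positivity
  have hpos : (0 : ℝ) < F.card := by exact_mod_cast hne.card_pos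
  have h1 := sq_sum_card_le F S (fun z => lineSquares S k z (b z))
    (fun z _ s hs => (mem_lineSquares.1 hs).1)
  have h2 : F.card * M ≤ ∑ z ∈ F, ((lineSquares S k z (b z)).card : ℝ) := by
    rw [← nsmul_eq_mul]; exact Finset.card_nsmul_le_sum F _ M hFM
  have h3 : ∑ z ∈ F, ∑ z' ∈ F,
      ((lineSquares S k z (b z) ∩ lineSquares S k z' (b z')).card : ℝ) ≤
      F.card * (72 * (k + 1) * 2 ^ k) := by
    rw [← nsmul_eq_mul]
    exact Finset.sum_le_card_nsmul F _ _ fun z hz =>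
      hF.sum_card_inter_lineSquares_le ht hF1 S b hz
  have h4 : (F.card * M) ^ 2 ≤ S.card * (F.card * (72 * (k + 1) * 2 ^ k)) :=
    (pow_le_pow_left₀ (by positivity) h2 2).trans (h1.trans (by gcongr))
  refine le_of_mul_le_mul_left ?_ hpos
  linarith

/-! ### Covers and Hausdorff measure -/

/-- A dyadic scale comparable to the diameter `d` of a set. Sets of diameter zero have no natural
scale and receive one of negligible cost `η`. -/
theorem exists_scale {α : ℝ} (hα : 0 < α) {d : ℝ≥0∞} (hd : d ≤ 1) {η : ℝ≥0∞} (hη : η ≠ 0) :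
    ∃ k : ℕ, d ≤ ENNReal.ofReal ((1 / 2) ^ k) ∧
      ENNReal.ofReal (2 ^ (-(α * k))) ≤ ENNReal.ofReal (2 ^ α) * d ^ α + η ∧
      (d = 0 → ENNReal.ofReal (2 ^ (-(α * k))) ≤ η) := by
  rcases eq_or_ne d 0 with rfl | hd0
  · have h1 : Tendsto (fun k : ℕ => ENNReal.ofReal ((2 ^ (-α)) ^ k)) atTop (𝓝 0) := by
      rw [← ENNReal.ofReal_zero]
      apply ENNReal.tendsto_ofReal
      apply tendsto_pow_atTop_nhds_zero_of_lt_one (by positivity)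
      exact Real.rpow_lt_one_of_one_lt_of_neg (by norm_num) (by linarith)
    obtain ⟨k, hk⟩ := (h1.eventually (gt_mem_nhds (pos_iff_ne_zero.2 hη))).exists
    have h2 : ENNReal.ofReal (2 ^ (-(α * k))) ≤ η := by
      rw [← neg_mul, Real.rpow_mul_natCast (by norm_num)]
      exact hk.le
    exact ⟨k, zero_le, h2.trans le_add_self, fun _ => h2⟩
  · have hdt : d ≠ ∞ := ne_top_of_le_ne_top ENNReal.one_ne_top hd
    lift d to ℝ≥0 using hdt
    have hdpos : (0 : ℝ) < d := by
      have : d ≠ 0 := by simpa using hd0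
      exact_mod_cast pos_iff_ne_zero.2 this
    obtain ⟨k, hk1, hk2⟩ := exists_nat_pow_near_of_lt_one hdpos (by exact_mod_cast hd)
      (by norm_num : (0 : ℝ) < 1 / 2) (by norm_num)
    refine ⟨k, ?_, ?_, fun h => absurd h hd0⟩
    · rw [← ENNReal.ofReal_coe_nnreal]
      exact ENNReal.ofReal_le_ofReal hk2
    · refine le_trans ?_ le_self_add
      rw [← ENNReal.ofReal_coe_nnreal, ENNReal.ofReal_rpow_of_pos hdpos,
        ← ENNReal.ofReal_mul (by positivity)]
      apply ENNReal.ofReal_le_ofReal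
      rw [← Real.mul_rpow (by norm_num) hdpos.le]
      have : (2 : ℝ) ^ (-(α * k)) = ((1 / 2) ^ k) ^ α := by
        rw [one_div, inv_pow, Real.inv_rpow (by positivity), ← Real.rpow_natCast,
          ← Real.rpow_mul (by norm_num), Real.rpow_neg (by norm_num), mul_comm]
      rw [this]
      apply Real.rpow_le_rpow (by positivity) _ hα.le
      rw [pow_succ] at hk1
      linarith

/-- A null set for the `α`-dimensional Hausdorff measure has covers of small `α`-cost in which
each set is assigned a dyadic scale. -/
theorem exists_cover_of_hausdorffMeasure_eq_zero {E : Type*} [EMetricSpace E] [MeasurableSpace E]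
    [BorelSpace E] {X : Set E} {α : ℝ} (hα : 0 < α) (hX : μH[α] X = 0) {ε : ℝ≥0∞} (hε : ε ≠ 0) :
    ∃ (U : ℕ → Set E) (κ : ℕ → ℕ), X ⊆ ⋃ n, U n ∧
      (∀ n, Metric.ediam (U n) ≤ ENNReal.ofReal ((1 / 2) ^ κ n)) ∧
      ∑' n, ENNReal.ofReal (2 ^ (-(α * κ n))) ≤ ε := by
  have hε2 : ε / 2 ≠ 0 := by simp [hε]
  set K : ℝ≥0∞ := ENNReal.ofReal (2 ^ α)
  have hK0 : K ≠ 0 := by simp [K]; positivity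
  have hKt : K ≠ ∞ := ENNReal.ofReal_ne_top
  have hlt : ⨅ (t : ℕ → Set E) (_ : X ⊆ ⋃ n, t n) (_ : ∀ n, Metric.ediam (t n) ≤ 1),
          ∑' n, ⨆ _ : (t n).Nonempty, Metric.ediam (t n) ^ α < K⁻¹ * (ε / 2) := by
    rw [Measure.hausdorffMeasure_apply] at hX
    refine lt_of_le_of_lt ?_ (pos_iff_ne_zero.2 (mul_ne_zero (ENNReal.inv_ne_zero.2 hKt) hε2))
    rw [← hX]
    exact le_iSup₂ (f := fun (r : ℝ≥0∞) (_ : 0 < r) =>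
        ⨅ (t : ℕ → Set E) (_ : X ⊆ ⋃ n, t n) (_ : ∀ n, Metric.ediam (t n) ≤ r),
          ∑' n, ⨆ _ : (t n).Nonempty, Metric.ediam (t n) ^ α) 1 one_pos
  simp only [iInf_lt_iff] at hlt
  obtain ⟨U, hU, hd, hsum⟩ := hlt
  obtain ⟨η, hηpos, hη⟩ := ENNReal.exists_pos_sum_of_countable' hε2 ℕ
  choose κ h1 h2 h3 using fun n => exists_scale hα (hd n) (hηpos n).ne'
  refine ⟨U, κ, hU, h1, ?_⟩
  calc ∑' n, ENNReal.ofReal (2 ^ (-(α * κ n)))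
      ≤ ∑' n, (K * (⨆ _ : (U n).Nonempty, Metric.ediam (U n) ^ α) + η n) := by
        refine ENNReal.tsum_le_tsum fun n => ?_
        rcases (U n).eq_empty_or_nonempty with h | h
        · exact (h3 n (by rw [h, Metric.ediam_empty])).trans le_add_self
        · simpa only [h, iSup_true] using h2 n
    _ = K * ∑' n, (⨆ _ : (U n).Nonempty, Metric.ediam (U n) ^ α) + ∑' n, η n := by
        rw [ENNReal.tsum_add, ENNReal.tsum_mul_left]
    _ ≤ K * (K⁻¹ * (ε / 2)) + ε / 2 := by gcongr
    _ = ε := by rw [← mul_assoc, ENNReal.mul_inv_cancel hK0 hKt, one_mul, ENNReal.add_halves]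

open Classical in
/-- A set of diameter at most `2^{-k}` lies in a `3 × 3` block of dyadic squares. -/
theorem exists_squares_of_ediam_le (U : Set (ℝ × ℝ)) {k : ℕ}
    (hU : Metric.ediam U ≤ ENNReal.ofReal ((1 / 2) ^ k)) :
    ∃ T : Finset (ℤ × ℤ), T.card ≤ 9 ∧ ∀ p ∈ U, (dyad k p.1, dyad k p.2) ∈ T := by
  rcases U.eq_empty_or_nonempty with rfl | ⟨p, hp⟩
  · exact ⟨∅, by simp, by simp⟩
  refine ⟨Finset.Icc (dyad k p.1 - 1) (dyad k p.1 + 1) ×ˢ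
    Finset.Icc (dyad k p.2 - 1) (dyad k p.2 + 1), ?_, ?_⟩
  · rw [Finset.card_product, Int.card_Icc, Int.card_Icc]
    have : ∀ a : ℤ, (a + 1 + 1 - (a - 1)).toNat = 3 := by intro a; omega
    rw [this, this]
  · intro q hq
    have h1 : dist q p ≤ (1 / 2) ^ k := by
      have := (Metric.edist_le_ediam_of_mem hq hp).trans hU
      rwa [edist_dist, ENNReal.ofReal_le_ofReal_iff (by positivity)] at this
    have h2 : ∀ x y : ℝ, dist x y ≤ (1 / 2) ^ k → |dyad k x - dyad k y| ≤ 1 := by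
      intro x y h
      apply abs_dyad_sub_le
      rw [Real.dist_eq] at h
      calc 2 ^ k * |x - y| ≤ 2 ^ k * (1 / 2) ^ k := by gcongr
        _ = ((1 : ℤ) : ℝ) := by rw [← mul_pow]; norm_num
    rw [Prod.dist_eq, max_le_iff] at h1
    have h3 := abs_le.1 (h2 _ _ h1.1)
    have h4 := abs_le.1 (h2 _ _ h1.2)
    rw [Finset.mem_product, Finset.mem_Icc, Finset.mem_Icc]
    dsimp only
    omega

open Classical in
/-- A planar null set for the `α`-dimensional Hausdorff measure is covered by finitely many dyadic
squares at each scale, with small total `α`-cost. -/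
theorem exists_dyadic_square_cover {X : Set (ℝ × ℝ)} {α : ℝ} (hα : 0 < α) (hX : μH[α] X = 0)
    {ε : ℝ≥0∞} (hε : ε ≠ 0) :
    ∃ S : ℕ → Finset (ℤ × ℤ), (∀ p ∈ X, ∃ k, (dyad k p.1, dyad k p.2) ∈ S k) ∧
      ∑' k, ((S k).card : ℝ≥0∞) * ENNReal.ofReal (2 ^ (-(α * k))) ≤ ε := by
  -- the bound by `1` makes the total cost finite, hence each scale is used finitely often
  have hε' : min (ε / 9) 1 ≠ 0 := by
    rw [← pos_iff_ne_zero]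
    exact lt_min (ENNReal.div_pos hε (by norm_num)) one_pos
  obtain ⟨U, κ, hXU, hU, hsum⟩ := exists_cover_of_hausdorffMeasure_eq_zero hα hX hε'
  choose T hT9 hT using fun n => exists_squares_of_ediam_le (U n) (hU n)
  have hfin : ∀ k, {n | κ n = k}.Finite := by
    intro k
    refine (ENNReal.finite_const_le_of_tsum_ne_top (a := fun n => ENNReal.ofReal (2 ^ (-(α * κ n))))
      (ne_top_of_le_ne_top ENNReal.one_ne_top (hsum.trans (min_le_right _ _)))
      (ε := ENNReal.ofReal (2 ^ (-(α * k)))) ?_).subset ?_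
    · simp; positivity
    · intro n hn
      rw [mem_ofPred_eq] at hn ⊢
      rw [hn]
  refine ⟨fun k => (hfin k).toFinset.biUnion T, ?_, ?_⟩
  · intro p hp
    obtain ⟨n, hn⟩ := mem_iUnion.1 (hXU hp)
    exact ⟨κ n, Finset.mem_biUnion.2 ⟨n, by simp, hT n p hn⟩⟩
  · calc ∑' k, (((hfin k).toFinset.biUnion T).card : ℝ≥0∞) * ENNReal.ofReal (2 ^ (-(α * k)))
        ≤ ∑' k, 9 * ∑' n, if κ n = k then ENNReal.ofReal (2 ^ (-(α * κ n))) else 0 := by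
          refine ENNReal.tsum_le_tsum fun k => ?_
          have h1 : ((hfin k).toFinset.biUnion T).card ≤ (hfin k).toFinset.card * 9 :=
            Finset.card_biUnion_le_card_mul _ _ _ fun n _ => hT9 n
          have h2 : ∑' n, (if κ n = k then ENNReal.ofReal (2 ^ (-(α * κ n))) else 0) =
              (hfin k).toFinset.card * ENNReal.ofReal (2 ^ (-(α * k))) := by
            rw [tsum_eq_sum (s := (hfin k).toFinset) (by
              intro n hn
              rw [if_neg (by simpa using hn)])]
            rw [← nsmul_eq_mul, ← Finset.sum_const]
            refine Finset.sum_congr rfl fun n hn => ?_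
            have : κ n = k := by simpa using hn
            rw [if_pos this, this]
          rw [h2, ← mul_assoc]
          gcongr
          rw [mul_comm]
          exact_mod_cast h1
      _ = 9 * ∑' n, ENNReal.ofReal (2 ^ (-(α * κ n))) := by
          rw [ENNReal.tsum_mul_left, ENNReal.tsum_comm]
          congr 1
          refine tsum_congr fun n => ?_
          rw [tsum_ite_eq']
      _ ≤ 9 * (ε / 9) := by gcongr; exact hsum.trans (min_le_left _ _)
      _ = ε := ENNReal.mul_div_cancel (by norm_num) (by norm_num)

/-! ### Slopes of the segments contained in a null set -/

theorem volume_dyadicInterval (k : ℕ) (i : ℤ) :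
    volume {x | dyad k x = i} = ENNReal.ofReal ((1 / 2) ^ k) := by
  have : {x | dyad k x = i} = Ico ((i : ℝ) / 2 ^ k) ((i + 1) / 2 ^ k) := by
    ext x
    have : (0 : ℝ) < 2 ^ k := by positivity
    rw [mem_ofPred_eq, dyad, Int.floor_eq_iff, mem_Ico, div_le_iff₀ this, lt_div_iff₀ this,
      mul_comm x]
  rw [this, Real.volume_Ico]
  congr 1
  rw [one_div, inv_pow]
  field_simp
  ring

/-- If a line segment over `[0, 1)` is covered by dyadic squares, then at some scale `k` it meets
many of them: the geometric weights `(1 - r) / 2 * r ^ k` have sum `1 / 2`, so the squares at some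
scale cover more than their share of the segment. -/
theorem exists_le_card_lineSquares {S : ℕ → Finset (ℤ × ℤ)} {m b r : ℝ} (hr0 : 0 ≤ r) (hr1 : r < 1)
    (h : ∀ x ∈ Ico (0 : ℝ) 1, ∃ k, (dyad k x, dyad k (m * x + b)) ∈ S k) :
    ∃ k, (1 - r) / 2 * r ^ k * 2 ^ k ≤ ((lineSquares (S k) k m b).card : ℝ) := by
  by_contra! hcon
  have hcov : Ico (0 : ℝ) 1 ⊆ ⋃ k, ⋃ s ∈ lineSquares (S k) k m b, {x | dyad k x = s.1} := by
    intro x hx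
    obtain ⟨k, hk⟩ := h x hx
    simp only [mem_iUnion]
    exact ⟨k, _, mem_lineSquares.2 ⟨hk, x, hx, rfl, rfl⟩, rfl⟩
  have hgeom : HasSum (fun k => (1 - r) / 2 * r ^ k) ((1 - r) / 2 * (1 - r)⁻¹) :=
    (hasSum_geometric_of_lt_one hr0 hr1).mul_left _
  have hr1' : 0 < 1 - r := by linarith
  have hlt : volume (Ico (0 : ℝ) 1) ≤ ENNReal.ofReal (1 / 2) := by
    calc volume (Ico (0 : ℝ) 1)
        ≤ ∑' k, ∑ s ∈ lineSquares (S k) k m b, volume {x | dyad k x = s.1} :=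
          (measure_mono hcov).trans ((measure_iUnion_le _).trans
            (ENNReal.tsum_le_tsum fun k => measure_biUnion_finset_le _ _))
      _ ≤ ∑' k : ℕ, ENNReal.ofReal ((1 - r) / 2 * r ^ k) := by
          refine ENNReal.tsum_le_tsum fun k => ?_
          simp only [volume_dyadicInterval, Finset.sum_const, nsmul_eq_mul]
          rw [← ENNReal.ofReal_natCast, ← ENNReal.ofReal_mul (by positivity)]
          apply ENNReal.ofReal_le_ofReal
          calc ((lineSquares (S k) k m b).card : ℝ) * (1 / 2) ^ k
              ≤ (1 - r) / 2 * r ^ k * 2 ^ k * (1 / 2) ^ k := by gcongr; exact (hcon k).le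
            _ = (1 - r) / 2 * r ^ k * (2 * (1 / 2)) ^ k := by rw [mul_pow]; ring
            _ = (1 - r) / 2 * r ^ k := by norm_num
      _ = ENNReal.ofReal (1 / 2) := by
          rw [← ENNReal.ofReal_tsum_of_nonneg (fun k => by positivity) hgeom.summable,
            hgeom.tsum_eq]
          congr 1
          field_simp
  rw [Real.volume_Ico, ENNReal.ofReal_le_ofReal_iff (by norm_num)] at hlt
  norm_num at hlt

theorem exists_add_one_le_mul_pow {R : ℝ} (hR : 1 < R) :
    ∃ K : ℝ, 0 < K ∧ ∀ k : ℕ, (k : ℝ) + 1 ≤ K * R ^ k := by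
  have h0 : 0 < R - 1 := by linarith
  refine ⟨1 + 1 / (R - 1), by positivity, fun k => ?_⟩
  have h1 := one_add_mul_sub_le_pow (by linarith : -1 ≤ R) k
  have h2 : 1 ≤ R ^ k := one_le_pow₀ hR.le
  have h3 : (k : ℝ) ≤ 1 / (R - 1) * R ^ k := by
    rw [one_div, ← div_eq_inv_mul, le_div_iff₀ h0]
    linarith
  linarith

/-- The estimate at one scale: slopes whose lines meet many squares of `S` have a dyadic cover whose
`t`-cost is controlled by the `α`-cost of `S`. The slack `1 + t - α > 0` absorbs both the loss `r^k`
in the number of squares met and the factor `k + 1` of the energy bound. -/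
theorem exists_cover_of_many_squares {t α : ℝ} (ht0 : 0 ≤ t) (ht1 : t ≤ 1) (hα : α < 1 + t) :
    ∃ C r : ℝ, 0 < C ∧ 0 ≤ r ∧ r < 1 ∧ ∀ (k : ℕ) (S : Finset (ℤ × ℤ)) (b : ℝ → ℝ) (A : Set ℝ),
      A ⊆ Ico 0 1 →
      (∀ m ∈ A, (1 - r) / 2 * r ^ k * 2 ^ k ≤ ((lineSquares S k m (b m)).card : ℝ)) →
      ∃ I : Finset (ℕ × ℤ), (∀ x ∈ A, ∃ c ∈ I, dyad c.1 x = c.2) ∧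
        ∑ c ∈ I, (2 : ℝ) ^ (-(t * c.1)) ≤ C * (S.card * 2 ^ (-(α * k))) := by
  set κ : ℝ := (1 + t - α) / 3 with hκ
  have hκ0 : 0 < κ := by linarith [hκ]
  obtain ⟨K, hK0, hK⟩ := exists_add_one_le_mul_pow
    (Real.one_lt_rpow (by norm_num : (1 : ℝ) < 2) hκ0)
  set r : ℝ := 2 ^ (-κ) with hr
  have hr0 : 0 < r := by positivity
  have hr1 : r < 1 := Real.rpow_lt_one_of_one_lt_of_neg (by norm_num) (by linarith)
  have hr1' : 0 < 1 - r := by linarith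
  refine ⟨576 * K / (1 - r) ^ 2, r, by positivity, hr0.le, hr1, ?_⟩
  intro k S b A hA hmany
  obtain ⟨F, hFA, hF, I, hI, hsum⟩ := exists_dyadicallyBounded_and_cover ht0 k hA
  refine ⟨I, hI, hsum.trans ?_⟩
  set M : ℝ := (1 - r) / 2 * r ^ k * 2 ^ k with hM
  have hM0 : 0 < M := by positivity
  have h1 := hF.sq_mul_card_le ht1 (hFA.trans hA) S b hM0.le fun z hz => hmany z (hFA hz)
  refine le_of_mul_le_mul_left ?_ (pow_pos hM0 2)
  have h2 : M ^ 2 * (2 * 2 ^ (-(t * k)) * F.card) ≤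
      2 * (2 : ℝ) ^ (-(t * k)) * (72 * (K * (2 ^ κ) ^ k) * 2 ^ k * S.card) := by
    calc M ^ 2 * (2 * 2 ^ (-(t * k)) * F.card)
        = 2 * (2 : ℝ) ^ (-(t * k)) * (M ^ 2 * F.card) := by ring
      _ ≤ 2 * (2 : ℝ) ^ (-(t * k)) * (72 * (k + 1) * 2 ^ k * S.card) := by gcongr
      _ ≤ _ := by gcongr; exact hK k
  refine h2.trans (le_of_eq ?_)
  have e1 : ((2 : ℝ) ^ κ) ^ k = 2 ^ (κ * k) := by rw [Real.rpow_mul_natCast (by norm_num)]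
  have e2 : r ^ k = 2 ^ (-κ * k) := by rw [hr, Real.rpow_mul_natCast (by norm_num)]
  have e3 : (2 : ℝ) ^ k = 2 ^ (k : ℝ) := (Real.rpow_natCast 2 k).symm
  -- the exponents balance because `3 κ = 1 + t - α`
  have e4 : (2 : ℝ) ^ (-(t * k)) * 2 ^ (κ * k) * 2 ^ (k : ℝ) =
      (2 ^ (-κ * k)) ^ 2 * (2 ^ (k : ℝ)) ^ 2 * 2 ^ (-(α * k)) := by
    simp only [sq, ← Real.rpow_add (by norm_num : (0 : ℝ) < 2)]
    congr 1
    rw [hκ]; ring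
  rw [e1, hM, e2, e3]
  calc 2 * (2 : ℝ) ^ (-(t * k)) * (72 * (K * 2 ^ (κ * k)) * 2 ^ (k : ℝ) * S.card)
      = 144 * K * S.card * (2 ^ (-(t * k)) * 2 ^ (κ * k) * 2 ^ (k : ℝ)) := by ring
    _ = 144 * K * S.card * ((2 ^ (-κ * k)) ^ 2 * (2 ^ (k : ℝ)) ^ 2 * 2 ^ (-(α * k))) := by rw [e4]
    _ = _ := by field_simp; ring

theorem hausdorffMeasure_eq_zero_of_dyadic_covers {t : ℝ} (ht : 0 < t) {A : Set ℝ}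
    (h : ∀ ε : ℝ≥0∞, ε ≠ 0 → ∃ I : ℕ → Finset (ℕ × ℤ),
      (∀ x ∈ A, ∃ k, ∃ c ∈ I k, dyad c.1 x = c.2) ∧
      ∑' k, ENNReal.ofReal (∑ c ∈ I k, (2 : ℝ) ^ (-(t * c.1))) ≤ ε) :
    μH[t] A = 0 := by
  set e : ℕ → ℝ≥0∞ := fun n => (n : ℝ≥0∞)⁻¹ with he
  have he0 : Tendsto e atTop (𝓝 0) := ENNReal.tendsto_inv_nat_nhds_zero
  choose I hIcov hIsum using fun n : ℕ => h (e n) (by simp [he])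
  set B : ∀ n : ℕ, (Σ k, {c // c ∈ I n k}) → Set ℝ := fun n i => {x | dyad i.2.1.1 x = i.2.1.2}
  have hterm : ∀ n (i : Σ k, {c // c ∈ I n k}),
      Metric.ediam (B n i) ^ t ≤ ENNReal.ofReal (2 ^ (-(t * i.2.1.1))) := by
    intro n i
    have h1 : Metric.ediam (B n i) ≤ ENNReal.ofReal (2 ^ (-(i.2.1.1 : ℝ))) := by
      refine Metric.ediam_le fun x hx y hy => ?_
      rw [edist_dist, Real.dist_eq]
      apply ENNReal.ofReal_le_ofReal
      have h2 := abs_sub_lt_of_dyad_eq (Eq.trans hx (Eq.symm hy))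
      rw [Real.rpow_neg (by norm_num), Real.rpow_natCast, ← one_div,
        le_div_iff₀' (by positivity)]
      exact h2.le
    calc Metric.ediam (B n i) ^ t ≤ ENNReal.ofReal (2 ^ (-(i.2.1.1 : ℝ))) ^ t := by gcongr
      _ = ENNReal.ofReal (2 ^ (-(t * i.2.1.1))) := by
        rw [ENNReal.ofReal_rpow_of_pos (by positivity), ← Real.rpow_mul (by norm_num)]
        congr 2; ring
  have htsum : ∀ n, ∑' i, Metric.ediam (B n i) ^ t ≤ e n := by
    intro n
    refine (ENNReal.tsum_le_tsum (hterm n)).trans ((le_of_eq ?_).trans (hIsum n))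
    rw [ENNReal.tsum_sigma']
    refine tsum_congr fun k => ?_
    rw [ENNReal.ofReal_sum_of_nonneg fun c _ => by positivity, ← Finset.tsum_subtype]
  have hle := Measure.hausdorffMeasure_le_liminf_tsum t A (l := atTop) (fun n => e n ^ t⁻¹)
    (by
      have := he0.ennrpow_const t⁻¹
      rwa [ENNReal.zero_rpow_of_pos (inv_pos.2 ht)] at this) B
    (Eventually.of_forall fun n i => by
      rw [ENNReal.le_rpow_inv_iff ht]
      exact (ENNReal.le_tsum i).trans (htsum n))
    (Eventually.of_forall fun n x hx => by
      obtain ⟨k, c, hc, hx⟩ := hIcov n x hx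
      exact mem_iUnion.2 ⟨⟨k, c, hc⟩, hx⟩)
  refine le_antisymm (hle.trans ?_) zero_le
  calc liminf (fun n => ∑' i, Metric.ediam (B n i) ^ t) atTop ≤ liminf e atTop :=
        liminf_le_liminf (Eventually.of_forall htsum)
    _ = 0 := he0.liminf_eq

/-- If `X` is null for the `α`-dimensional Hausdorff measure and contains a segment over `[0, 1)` of
each slope in `A`, then `A` is null in every dimension `t > α - 1`. -/
theorem hausdorffMeasure_slopes_eq_zero {t α : ℝ} (ht0 : 0 < t) (ht1 : t ≤ 1) (hα0 : 0 < α)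
    (hα : α < 1 + t) {A : Set ℝ} (hA : A ⊆ Ico 0 1) {X : Set (ℝ × ℝ)} {b : ℝ → ℝ}
    (hb : ∀ m ∈ A, ∀ x ∈ Ico (0 : ℝ) 1, (x, m * x + b m) ∈ X) (hX : μH[α] X = 0) :
    μH[t] A = 0 := by
  obtain ⟨C, r, hC, hr0, hr1, hcover⟩ := exists_cover_of_many_squares ht0.le ht1 hα
  apply hausdorffMeasure_eq_zero_of_dyadic_covers ht0
  intro ε hε
  have hC0 : ENNReal.ofReal C ≠ 0 := by simpa using hC
  obtain ⟨S, hS, hsum⟩ := exists_dyadic_square_cover hα0 hX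
    (ENNReal.div_pos hε (ENNReal.ofReal_ne_top (r := C))).ne'
  choose I hI hIsum using fun k => hcover k (S k) b
    {m ∈ A | (1 - r) / 2 * r ^ k * 2 ^ k ≤ ((lineSquares (S k) k m (b m)).card : ℝ)}
    (fun m hm => hA hm.1) (fun m hm => hm.2)
  refine ⟨I, ?_, ?_⟩
  · intro m hm
    obtain ⟨k, hk⟩ := exists_le_card_lineSquares (S := S) hr0 hr1
      fun x hx => hS _ (hb m hm x hx)
    exact ⟨k, hI k m ⟨hm, hk⟩⟩
  · calc ∑' k, ENNReal.ofReal (∑ c ∈ I k, (2 : ℝ) ^ (-(t * c.1)))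
        ≤ ∑' k, ENNReal.ofReal C * ((S k).card * ENNReal.ofReal (2 ^ (-(α * k)))) := by
          refine ENNReal.tsum_le_tsum fun k => ?_
          rw [← ENNReal.ofReal_natCast, ← ENNReal.ofReal_mul (Nat.cast_nonneg _),
            ← ENNReal.ofReal_mul hC.le]
          exact ENNReal.ofReal_le_ofReal (hIsum k)
      _ ≤ ENNReal.ofReal C * (ε / ENNReal.ofReal C) := by
          rw [ENNReal.tsum_mul_left]
          gcongr
      _ = ε := ENNReal.mul_div_cancel hC0 ENNReal.ofReal_ne_top

/-- The theorem for segments given as graphs over `[0, 1]`. The bound `1 ≤ dimH X`, which covers the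
case `dimH A = 0`, comes from projecting to the horizontal axis. -/
theorem dimH_slopes_add_one_le {A : Set ℝ} (hA : A ⊆ Ico 0 1) (hne : A.Nonempty)
    {X : Set (ℝ × ℝ)} {b : ℝ → ℝ}
    (hb : ∀ m ∈ A, ∀ x ∈ Icc (0 : ℝ) 1, (x, m * x + b m) ∈ X) :
    dimH A + 1 ≤ dimH X := by
  have h1 : 1 ≤ dimH X := by
    have hsub : Icc (0 : ℝ) 1 ⊆ Prod.fst '' X := by
      intro x hx
      obtain ⟨m, hm⟩ := hne
      exact ⟨_, hb m hm x hx, rfl⟩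
    calc (1 : ℝ≥0∞) = dimH (Icc (0 : ℝ) 1) := by
          rw [Real.dimH_of_nonempty_interior (by rw [interior_Icc]; exact ⟨1 / 2, by norm_num⟩)]
          simp
      _ ≤ dimH (Prod.fst '' X) := dimH_mono hsub
      _ ≤ dimH X := LipschitzWith.prod_fst.dimH_image_le X
  have hA1 : dimH A ≤ 1 := (dimH_mono (subset_univ A)).trans_eq Real.dimH_univ
  have hAX : ∀ t : ℝ≥0, 0 < t → (t : ℝ≥0∞) < dimH A → (t : ℝ≥0∞) + 1 ≤ dimH X := by
    intro t ht0 ht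
    by_contra! hlt
    obtain ⟨α, hXα, hα⟩ := ENNReal.lt_iff_exists_nnreal_btwn.1 hlt
    have hα0 : 0 < α := by
      have : (0 : ℝ≥0∞) < α := lt_of_le_of_lt zero_le hXα
      exact_mod_cast this
    have ht1 : t ≤ 1 := by exact_mod_cast (ht.trans_le hA1).le
    have hα' : α < 1 + t := by rw [add_comm]; exact_mod_cast hα
    have hz := hausdorffMeasure_slopes_eq_zero (t := t) (α := α) ht0 (by exact_mod_cast ht1)
      hα0 (by exact_mod_cast hα') hA (fun m hm x hx => hb m hm x (Ico_subset_Icc_self hx))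
      (hausdorffMeasure_of_dimH_lt hXα)
    rw [hausdorffMeasure_of_lt_dimH ht] at hz
    exact ENNReal.top_ne_zero hz
  rw [← tsub_add_cancel_of_le h1]
  gcongr
  refine ENNReal.le_of_forall_nnreal_lt fun t ht => ?_
  rcases eq_zero_or_pos t with rfl | ht0
  · simp
  · exact ENNReal.le_sub_of_add_le_right ENNReal.one_ne_top (hAX t ht0 ht)

/-! ### From directions on the circle to slopes -/

theorem sq_add_sq_of_mem_sphere {e : EuclideanSpace ℝ (Fin 2)}
    (he : e ∈ Metric.sphere (0 : EuclideanSpace ℝ (Fin 2)) 1) (i : Fin 2) :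
    e i ^ 2 + e (1 - i) ^ 2 = 1 := by
  rw [mem_sphere_zero_iff_norm, EuclideanSpace.norm_eq, Real.sqrt_eq_one, Fin.sum_univ_two] at he
  simp only [Real.norm_eq_abs, sq_abs] at he
  fin_cases i
  · simpa using he
  · simp; linarith

/-- The unit vectors with nonzero `i`-th coordinate form two arcs, each a smooth image of the
slope. -/
theorem dimH_le_dimH_slopes (i : Fin 2) {P : Set (EuclideanSpace ℝ (Fin 2))}
    (hP : P ⊆ Metric.sphere 0 1) (hi : ∀ e ∈ P, e i ≠ 0) (z : ℝ) :
    dimH P ≤ dimH ((fun e : EuclideanSpace ℝ (Fin 2) => e (1 - i) / e i - z) '' P) := by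
  set A := (fun e : EuclideanSpace ℝ (Fin 2) => e (1 - i) / e i - z) '' P
  let g : ℝ → EuclideanSpace ℝ (Fin 2) := fun m =>
    WithLp.toLp 2 fun l =>
      if l = i then (√(1 + (m + z) ^ 2))⁻¹ else (m + z) * (√(1 + (m + z) ^ 2))⁻¹
  have hsqrt : ContDiff ℝ 1 fun m : ℝ => (√(1 + (m + z) ^ 2))⁻¹ := by
    refine ContDiff.inv (ContDiff.sqrt (by fun_prop) fun m => ?_) fun m => ?_
    · positivity
    · positivity
  have hg : ContDiff ℝ 1 g := by
    rw [contDiff_euclidean]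
    intro l
    by_cases h : l = i
    · simpa only [g, h, if_true] using hsqrt
    · simp only [g, h, if_false]
      exact ContDiff.mul (by fun_prop) hsqrt
  have hsub : P ⊆ g '' A ∪ (fun m => -g m) '' A := by
    intro e he
    have hm : e (1 - i) / e i - z ∈ A := ⟨e, he, rfl⟩
    have h0 := hi e he
    have h1 := sq_add_sq_of_mem_sphere (hP he) i
    have h2 : (√(1 + (e (1 - i) / e i - z + z) ^ 2))⁻¹ = |e i| := by
      have : 1 + (e (1 - i) / e i - z + z) ^ 2 = (|e i|⁻¹) ^ 2 := by
        rw [inv_pow, sq_abs]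
        field_simp
        rw [sub_add_cancel]
        field_simp
        linarith
      rw [this, Real.sqrt_sq (by positivity), inv_inv]
    have hne : (1 - i) ≠ i := by fin_cases i <;> simp
    have hcases : ∀ l, l = i ∨ l = 1 - i := by fin_cases i <;> intro l <;> fin_cases l <;> simp
    rcases lt_or_gt_of_ne h0 with h | h
    · right
      refine ⟨_, hm, ?_⟩
      ext l
      rcases hcases l with rfl | rfl
      · simp only [g, PiLp.neg_apply, if_true, h2, abs_of_neg h]; ring
      · simp only [g, PiLp.neg_apply, hne, if_false, h2, abs_of_neg h]; field_simp; ring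
    · left
      refine ⟨_, hm, ?_⟩
      ext l
      rcases hcases l with rfl | rfl
      · simp only [g, if_true, h2, abs_of_pos h]
      · simp only [g, hne, if_false, h2, abs_of_pos h]; field_simp; ring
  refine (dimH_mono hsub).trans ?_
  rw [dimH_union]
  exact max_le (hg.contDiffOn.dimH_image_le convex_univ (subset_univ A))
    (hg.neg.contDiffOn.dimH_image_le convex_univ (subset_univ A))

/-- The directions `e` whose slope over the `i`-th axis lies in `[z, z + 1)` and for which `X`
contains a unit segment along `e` lying over all of `[n / 4, (n + 1) / 4]` on that axis. -/
def alignedDirections (X : Set (EuclideanSpace ℝ (Fin 2))) (i : Fin 2) (n z : ℤ) :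
    Set (EuclideanSpace ℝ (Fin 2)) :=
  {e | e i ≠ 0 ∧ ⌊e (1 - i) / e i⌋ = z ∧ ∃ a, segment ℝ a (a + e) ⊆ X ∧
    ∀ x ∈ Icc (0 : ℝ) 1, ((n + x) / 4 - a i) / e i ∈ Icc (0 : ℝ) 1}

theorem dimH_add_one_le_of_subset_alignedDirections {X P : Set (EuclideanSpace ℝ (Fin 2))}
    {i : Fin 2} {n z : ℤ} (hPS : P ⊆ Metric.sphere 0 1) (hP : P ⊆ alignedDirections X i n z)
    (hne : P.Nonempty) : dimH P + 1 ≤ dimH X := by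
  set slope := fun e : EuclideanSpace ℝ (Fin 2) => e (1 - i) / e i - z with hslope
  -- an affine change of coordinates that puts the segments over `[0, 1]`, with slopes in `[0, 1)`
  let Φ : EuclideanSpace ℝ (Fin 2) → ℝ × ℝ :=
    fun p => (4 * p i - n, 4 * p (1 - i) - z * (4 * p i - n))
  have hΦ : ContDiff ℝ 1 Φ := by
    have h (l : Fin 2) : ContDiff ℝ 1 fun p : EuclideanSpace ℝ (Fin 2) => p l :=
      (EuclideanSpace.proj (𝕜 := ℝ) l).contDiff
    have h1 := h i
    have h2 := h (1 - i)
    fun_prop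
  have hA : slope '' P ⊆ Ico 0 1 := by
    rintro _ ⟨e, he, rfl⟩
    have hz := (hP he).2.1
    rw [Int.floor_eq_iff] at hz
    simp only [hslope]
    constructor <;> linarith [hz.1, hz.2]
  have hex : ∀ m ∈ slope '' P, ∃ b : ℝ, ∀ x ∈ Icc (0 : ℝ) 1, (x, m * x + b) ∈ Φ '' X := by
    rintro _ ⟨e, he, rfl⟩
    obtain ⟨h0, -, a, haX, ha⟩ := hP he
    refine ⟨4 * a (1 - i) + e (1 - i) / e i * (n - 4 * a i), fun x hx => ?_⟩
    refine ⟨a + (((n + x) / 4 - a i) / e i) • e, haX ?_, ?_⟩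
    · rw [segment_eq_image']
      exact ⟨_, ha x hx, by simp⟩
    · simp only [Φ, hslope, PiLp.add_apply, PiLp.smul_apply, smul_eq_mul, Prod.mk.injEq]
      constructor
      · field_simp; ring
      · field_simp; ring
  choose! b hb using hex
  calc dimH P + 1 ≤ dimH (slope '' P) + 1 := by
        gcongr
        exact dimH_le_dimH_slopes i hPS (fun e he => (hP he).1) z
    _ ≤ dimH (Φ '' X) := dimH_slopes_add_one_le hA (hne.image _) hb
    _ ≤ dimH X := hΦ.contDiffOn.dimH_image_le convex_univ (subset_univ X)

/-- One coordinate of a unit vector `e` is at least `1 / 2` in absolute value; a unit segment along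
`e` projects to that axis onto an interval of length at least `1 / 2`, which contains some
`[n / 4, (n + 1) / 4]`. -/
theorem exists_mem_alignedDirections {X : Set (EuclideanSpace ℝ (Fin 2))}
    {a e : EuclideanSpace ℝ (Fin 2)} (he : e ∈ Metric.sphere (0 : EuclideanSpace ℝ (Fin 2)) 1)
    (ha : segment ℝ a (a + e) ⊆ X) : ∃ i n z, e ∈ alignedDirections X i n z := by
  have hi : ∃ i, 1 / 2 ≤ |e i| := by
    by_contra! h
    have h1 := sq_add_sq_of_mem_sphere he 0
    rw [← sq_abs, ← sq_abs (e (1 - 0))] at h1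
    nlinarith [h 0, h (1 - 0), abs_nonneg (e 0), abs_nonneg (e (1 - 0))]
  obtain ⟨i, hi⟩ := hi
  have h0 : e i ≠ 0 := by intro h; rw [h] at hi; norm_num at hi
  refine ⟨i, ⌈4 * min (a i) (a i + e i)⌉, _, h0, rfl, a, ha, fun x hx => ?_⟩
  have h1 := Int.le_ceil (4 * min (a i) (a i + e i))
  have h2 := Int.ceil_lt_add_one (4 * min (a i) (a i + e i))
  obtain ⟨hx0, hx1⟩ := hx
  rcases lt_or_gt_of_ne h0 with h | h
  · rw [abs_of_neg h] at hi
    rw [min_eq_right (by linarith)] at h1 h2 ⊢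
    exact ⟨div_nonneg_of_nonpos (by linarith) h.le, (div_le_one_of_neg h).2 (by linarith)⟩
  · rw [abs_of_pos h] at hi
    rw [min_eq_left (by linarith)] at h1 h2 ⊢
    exact ⟨div_nonneg (by linarith) h.le, (div_le_one h).2 (by linarith)⟩

theorem mainTheorem5
    (Ω : Set (EuclideanSpace ℝ (Fin 2)))
    (hΩS : Ω ⊆ Metric.sphere (0 : EuclideanSpace ℝ (Fin 2)) 1)
    (hΩ : MeasurableSet Ω) (hne : Ω.Nonempty)
    (X : Set (EuclideanSpace ℝ (Fin 2))) (hX : IsKakeyaFor Ω X) :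
    dimH Ω + 1 ≤ dimH X := by
  let P : Fin 2 × ℤ × ℤ → Set (EuclideanSpace ℝ (Fin 2)) :=
    fun q => Ω ∩ alignedDirections X q.1 q.2.1 q.2.2
  have hP : ∀ q, (P q).Nonempty → dimH (P q) + 1 ≤ dimH X := fun q hq =>
    dimH_add_one_le_of_subset_alignedDirections (inter_subset_left.trans hΩS)
      inter_subset_right hq
  have hcov : ∀ e ∈ Ω, ∃ q, e ∈ P q := by
    intro e he
    obtain ⟨a, ha⟩ := hX e he
    obtain ⟨i, n, z, h⟩ := exists_mem_alignedDirections (hΩS he) ha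
    exact ⟨(i, n, z), he, h⟩
  have h1 : 1 ≤ dimH X := by
    obtain ⟨e, he⟩ := hne
    obtain ⟨q, hq⟩ := hcov e he
    exact le_add_self.trans (hP q ⟨e, hq⟩)
  rw [← tsub_add_cancel_of_le h1]
  gcongr
  calc dimH Ω ≤ dimH (⋃ q, P q) := dimH_mono fun e he => mem_iUnion.2 (hcov e he)
    _ = ⨆ q, dimH (P q) := dimH_iUnion P
    _ ≤ dimH X - 1 := iSup_le fun q => by
        rcases (P q).eq_empty_or_nonempty with h | h
        · rw [h, dimH_empty]; exact zero_le
        · exact ENNReal.le_sub_of_add_le_right ENNReal.one_ne_top (hP q h)
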